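/- For a linear operator $Z$ on a finite-dimensional real normed space let $\phi_s(Z)=\sum_{k\ge 0} Z^k/(k+s)!$, $s=0,1,2,\dots$ (so $\phi_0=\exp$). An explicit ETD Runge–Kutta (ETD-RK) method with $S$ stages is given by nodes $c_i\in\mathbb R$, $c_1=0$, and coefficient functions $a_{i,j}$ ($1\le j<i\le S$) and $b_j$ ($1\le j\le S$), each of which is a finite real linear combination of functions $z\mapsto\phi_s(cz)$, $c\in\mathbb R$. For a problem $\partial_t V=F[V]$, a linear operator $A$, the remainder $r[v]=F[v]-Av$ and a step size $\Delta t>0$, it computes iterates $V_n$ by $$v_{n,i}=\phi_0(c_i\Delta tA)V_n+\Delta t\sum_{j<i}a_{i,j}(\Delta tA)\,r[v_{n,j}],\qquad V_{n+1}=\phi_0(\Delta tA)V_n+\Delta t\sum_{j=1}^S b_j(\Delta tA)\,r[v_{n,j}].$$ The method has (convergence) order $q$ if for every finite-dimensional real normed space $E$, every linear $A:E\to E$, every $T>0$, every open $U\subseteq E$ and smooth $F:U\to E$, and every solution $V:[0,T]\to U$ of $\partial_tV=F[V]$, there are $C$ and $\tau_0>0$ with $\|V_n-V(n\Delta t)\|\le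 C\,\Delta t^{q}$ for all $0<\Delta t\le\tau_0$ and all $n\ge 0$ with $n\Delta t\le T$, where $V_n$ are the iterates from $V_0=V(0)$. **Proposition.** Let an ETD-RK method have order $q\ge 1$, let $p\ge 1$ be an integer and $\gamma>0$. Let $E$ be a finite-dimensional real normed space, $A:E\to E$ linear, $U\subseteq E$ open, $F:U\to E$ smooth, $T>0$, and let $V:[0,T]\to U$ solve $\partial_tV=F[V]$, $V(0)=V_0$. Let $V_{\gamma,n}$ be the iterates, from $V_{\gamma,0}=V_0$, of the scheme obtained by replacing in the two formulas above each occurrence of $\phi_s(c\,\Delta tA)$ (including $s=0$) by $$\phi_{s,\gamma}(c,\Delta tA)=\phi_s\bigl(c\,(\Delta tA-(-\Delta t^2A^2/\gamma^2)^p)\bigr),$$ with the same remainder $r[v]=F[v]-Av$. Then there are $C$ and $\tau_0>0$, independent of $\Delta t$ and $n$, such that for all $0<\Delta t\le\tau_0$ the modified problem $$\partial_tV_\gamma=F[V_\gamma]-\frac{\Delta t^{2p-1}}{\gamma^{2p}}(-A^2)^pV_\gamma,\qquad V_\gamma(0)=V_0,$$ has a unique solution $V_\gamma:[0,T]\to U$,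 and for all $n\ge0$ with $n\Delta t\le T$ the iterate $V_{\gamma,n}$ and the internal stages of the modified step that starts at $V_{\gamma,n}$ lie in $U$, and $$\|V_{\gamma,n}-V_\gamma(n\Delta t)\|\le C\,\Delta t^{q}.$$ -/

import Mathlib

open Set
open scoped ContDiff Nat

namespace ETD

variable {E : Type*} [NormedAddCommGroup E] [NormedSpace ℝ E]

/-- The `φ`-function `φ_s(Z) = ∑_{k ≥ 0} Z^k / (k + s)!` of a linear operator `Z`;
`φ_0 = exp`. -/
noncomputable def phi (s : ℕ) (Z : E →L[ℝ] E) : E →L[ℝ] E :=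
  ∑' k : ℕ, (((k + s)! : ℕ) : ℝ)⁻¹ • Z ^ k

/-- The modified `φ`-function `φ_{s,γ}(c, Z) = φ_s(c (Z - (-Z² / γ²)^p))`. -/
noncomputable def phiMod (p : ℕ) (γ : ℝ) (s : ℕ) (c : ℝ) (Z : E →L[ℝ] E) : E →L[ℝ] E :=
  phi s (c • (Z - (-((γ ^ 2)⁻¹ • Z ^ 2)) ^ p))

/-- A (formal) finite linear combination of the functions `z ↦ φ_s(c z)`:
the number attached to `(s, c)` is the weight of `φ_s(c ·)`. -/
abbrev PhiComb : Type := (ℕ × ℝ) →₀ ℝ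

/-- The value of a combination of `φ`-functions, once each occurrence of `φ_s(c ·)` has been given
the value `Φ s c`. -/
noncomputable def PhiComb.eval (w : PhiComb) (Φ : ℕ → ℝ → E →L[ℝ] E) : E →L[ℝ] E :=
  w.sum fun sc α => α • Φ sc.1 sc.2

/-- The tableau of an explicit exponential (ETD) Runge-Kutta method. The stages are numbered from
`0`; row `i` of `a` holds the coefficient functions `a_{i,j}` with `j < i` only, the other ones
being zero as the method is explicit. -/
structure Method where
  /-- number of stages -/
  S : ℕ
  /-- intermediate time points -/
  c : Fin S → ℝ
  /-- coefficient functions of the internal stages -/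
  a : (i : Fin S) → Fin i.val → PhiComb
  /-- coefficient functions of the final stage -/
  b : Fin S → PhiComb
  /-- the first stage is the current iterate -/
  c_first : ∀ i : Fin S, i.val = 0 → c i = 0

namespace Method

/-- The internal stages of one step of size `h` from `v`, with remainder `r`, where `Φ s c` is the
operator that stands for `φ_s(c h A)`:
`v_i = φ_0(c_i h A) v + h ∑_{j < i} a_{i,j}(h A) r(v_j)`. -/
noncomputable def stage (M : Method) (Φ : ℕ → ℝ → E →L[ℝ] E) (h : ℝ)
    (r : E → E) (v : E) (i : Fin M.S) : E :=
  Φ 0 (M.c i) v + h • ∑ j : Fin i.val,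
    (M.a i j).eval Φ (r (M.stage Φ h r v ⟨j.val, j.isLt.trans i.isLt⟩))
termination_by i.val
decreasing_by exact j.isLt

/-- One step of size `h`: `φ_0(h A) v + h ∑_j b_j(h A) r(v_j)`. -/
noncomputable def step (M : Method) (Φ : ℕ → ℝ → E →L[ℝ] E) (h : ℝ)
    (r : E → E) (v : E) : E :=
  Φ 0 1 v + h • ∑ j : Fin M.S, (M.b j).eval Φ (r (M.stage Φ h r v j))

/-- The iterates of the scheme, from the initial value `v`. -/
noncomputable def iter (M : Method) (Φ : ℕ → ℝ → E →L[ℝ] E) (h : ℝ)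
    (r : E → E) (v : E) : ℕ → E
  | 0 => v
  | n + 1 => M.step Φ h r (M.iter Φ h r v n)

end Method

/-- The nonlinear remainder `r[v] = F[v] - A v` of the splitting `F[v] = A v + r[v]`. -/
def remainder (A : E →L[ℝ] E) (F : E → E) (v : E) : E :=
  F v - A v

/-- `V` solves `∂_t V = F[V]` on `[0, T]`, with values in the domain `U` of `F`. -/
def IsSolution (F : E → E) (U : Set E) (T : ℝ) (V : ℝ → E) : Prop :=
  ∀ t ∈ Icc (0 : ℝ) T, V t ∈ U ∧ HasDerivWithinAt V (F (V t)) (Icc 0 T) t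

/-- The method has convergence order `q`: for every smooth problem `∂_t V = F[V]` that has a
solution `V` on `[0, T]` and every choice of the linear operator `A` in the splitting `F = A + r`,
the global error on `[0, T]` is bounded by `C h^q` for all small step sizes `h`.
The state space is any finite-dimensional normed space. -/
def Method.HasOrder (M : Method) (q : ℕ) : Prop :=
  ∀ (E : Type) [NormedAddCommGroup E] [NormedSpace ℝ E] [FiniteDimensional ℝ E]
    (A : E →L[ℝ] E) (U : Set E) (F : E → E) (T : ℝ) (V : ℝ → E),
    IsOpen U → ContDiffOn ℝ ∞ F U → 0 < T → IsSolution F U T V →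
    ∃ C : ℝ, ∃ h₀ : ℝ, 0 < h₀ ∧ ∀ h : ℝ, 0 < h → h ≤ h₀ → ∀ n : ℕ, n * h ≤ T →
      ‖M.iter (fun s c => phi s (c • (h • A))) h (remainder A F) (V 0) n - V (n * h)‖ ≤ C * h ^ q

/-- The right-hand side of the modified problem:
`F[v] - (h^(2p-1) / γ^(2p)) (-A²)^p v`. -/
noncomputable def modifiedRhs (p : ℕ) (γ h : ℝ) (A : E →L[ℝ] E) (F : E → E) (v : E) : E :=
  F v - (h ^ (2 * p - 1) / γ ^ (2 * p)) • ((-(A ^ 2)) ^ p) v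

end ETD

/-!
The modified scheme is the original scheme for another splitting. With `B = (-A²)^p` and
`ε = h^(2p-1) / γ^(2p)`, one has `h A - (-h² A² / γ²)^p = h (A - ε B)` (`phiMod_eq_phiFamily`),
and the remainder `F - A` equals `(F - ε B) - (A - ε B)`; so the modified iterates are those of the method
for the problem `v' = F v - ε B v`, split by `A - ε B`. The order hypothesis cannot be applied to
this problem directly, as its constants depend on the problem, hence on `h`. A bound that is uniform
in `ε` is obtained by passing through the order conditions.

* For a smooth family of problems `v' = F (v, ε)`, split by `A ε`, one step is a smooth function
  `Ψ (h, v, ε)` (`contDiff_stepMap`). If the method has order `q`, then for each fixed `ε` the time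
  derivatives of `Ψ` at `h = 0` agree with those of the flow up to order `q`
  (`orderConditions_of_convergence`): local errors of a lower order would add up to a global error
  that is not `O(h^q)`.
* Taylor's formula then gives local errors `O(h^(q+1))`, uniformly for `ε ∈ [0, 1]` and bounded
  values, and stability gives a global error `C h^q` with `C` independent of `ε`
  (`exists_uniform_convergence`).

To have everything defined globally, `F` and `B` are cut off smoothly outside a neighbourhood of the
trajectory of `V`. For bounded Lipschitz fields the modified solution exists on all of `[0, T]` and is
`O(ε)`-close to `V` by Grönwall's inequality (`exists_perturbed_solution`). For small `h` the
modified solution, the iterates and the stages (`exists_stageMap_near`) thus stay where the cut-off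
changes nothing.
-/

namespace ETD

variable {E : Type*} [NormedAddCommGroup E] [NormedSpace ℝ E]

/-! ### Smoothness of the `φ`-functions and of the step map -/

theorem phi_zero_zero : phi 0 (0 : E →L[ℝ] E) = 1 := by
  unfold phi
  rw [tsum_eq_single 0]
  · simp
  · intro k hk
    simp [hk]

/-- `φ_s` is the sum of a power series with infinite radius of convergence. -/
theorem contDiff_phi [CompleteSpace E] (s : ℕ) :
    ContDiff ℝ ∞ (phi s : (E →L[ℝ] E) → (E →L[ℝ] E)) := by
  set c : ℕ → ℝ := fun k => (((k + s)! : ℕ) : ℝ)⁻¹ with hc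
  have hpos : ∀ k, c k ≠ 0 := fun k => by
    simp only [hc]
    positivity
  have hrad : (FormalMultilinearSeries.ofScalars (E →L[ℝ] E) c).radius = ⊤ := by
    refine FormalMultilinearSeries.ofScalars_radius_eq_top_of_tendsto _ _
      (Filter.Eventually.of_forall hpos) ?_
    have hlim := (Filter.tendsto_add_atTop_iff_nat (f := fun n : ℕ => (n : ℝ)⁻¹) (s + 1)).mpr
      tendsto_inv_atTop_nhds_zero_nat
    refine hlim.congr fun n => ?_
    simp only [hc, norm_inv, Nat.succ_eq_add_one]
    rw [show n + 1 + s = (n + s) + 1 by ring, Nat.factorial_succ]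
    have : (((n + s)! : ℕ) : ℝ) ≠ 0 := by positivity
    simp only [RCLike.norm_natCast]
    push_cast
    field_simp
    ring
  have hphi : (phi s : (E →L[ℝ] E) → (E →L[ℝ] E)) =
      (FormalMultilinearSeries.ofScalars (E →L[ℝ] E) c).sum := by
    funext Z
    exact (FormalMultilinearSeries.ofScalars_sum_eq c Z).symm
  have hball := (FormalMultilinearSeries.ofScalars (E →L[ℝ] E) c).hasFPowerSeriesOnBall
    (by rw [hrad]; exact ENNReal.zero_lt_top)
  rw [hrad] at hball
  rw [hphi]
  apply AnalyticOnNhd.contDiff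
  have := hball.analyticOnNhd
  rwa [Metric.eball_top] at this

theorem contDiff_phiCombEval {X : Type*} [NormedAddCommGroup X] [NormedSpace ℝ X]
    (w : PhiComb) {Φ : X → ℕ → ℝ → E →L[ℝ] E} (hΦ : ∀ s c, ContDiff ℝ ∞ fun x => Φ x s c) :
    ContDiff ℝ ∞ fun x => w.eval (Φ x) := by
  unfold PhiComb.eval Finsupp.sum
  exact ContDiff.sum fun i _ => (hΦ _ _).const_smul _

/-- The operators `φ_s(c h A_ε)`, for a family `ε ↦ A_ε` of operators. -/
noncomputable def phiFamily (A : ℝ → E →L[ℝ] E) (h ε : ℝ) (s : ℕ) (c : ℝ) : E →L[ℝ] E :=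
  phi s (c • (h • A ε))

/-- The internal stages of the method for the problem `v' = F (v, ε)`, split by `A ε`, as a
function of the step size `h`, the current value `v` and the parameter `ε`. -/
noncomputable def stageMap (M : Method) (A : ℝ → E →L[ℝ] E) (F : E × ℝ → E) (i : Fin M.S)
    (z : ℝ × E × ℝ) : E :=
  M.stage (phiFamily A z.1 z.2.2) z.1 (remainder (A z.2.2) fun v => F (v, z.2.2)) z.2.1 i

/-- One step of the method for the problem `v' = F (v, ε)`, split by `A ε`, as a function of the
step size `h`, the current value `v` and the parameter `ε`. -/
noncomputable def stepMap (M : Method) (A : ℝ → E →L[ℝ] E) (F : E × ℝ → E)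
    (z : ℝ × E × ℝ) : E :=
  M.step (phiFamily A z.1 z.2.2) z.1 (remainder (A z.2.2) fun v => F (v, z.2.2)) z.2.1

theorem contDiff_remainder_comp {A : ℝ → E →L[ℝ] E} {F : E × ℝ → E}
    (hA : ContDiff ℝ ∞ A) (hF : ContDiff ℝ ∞ F) {f : ℝ × E × ℝ → E} (hf : ContDiff ℝ ∞ f) :
    ContDiff ℝ ∞ fun z : ℝ × E × ℝ => remainder (A z.2.2) (fun v => F (v, z.2.2)) (f z) := by
  unfold remainder
  have h2 : ContDiff ℝ ∞ fun z : ℝ × E × ℝ => A z.2.2 := hA.comp (by fun_prop)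
  have h3 : ContDiff ℝ ∞ fun z : ℝ × E × ℝ => z.2.2 := by fun_prop
  exact (hF.comp (hf.prodMk h3)).sub (h2.clm_apply hf)

section smoothness

variable [CompleteSpace E] {A : ℝ → E →L[ℝ] E} {F : E × ℝ → E}

theorem contDiff_phiFamily (hA : ContDiff ℝ ∞ A) (s : ℕ) (c : ℝ) :
    ContDiff ℝ ∞ fun z : ℝ × E × ℝ => phiFamily A z.1 z.2.2 s c := by
  unfold phiFamily
  have h2 : ContDiff ℝ ∞ fun z : ℝ × E × ℝ => A z.2.2 := hA.comp (by fun_prop)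
  exact (contDiff_phi s).comp ((contDiff_fst.smul h2).const_smul c)

theorem contDiff_stageMap (M : Method) (hA : ContDiff ℝ ∞ A) (hF : ContDiff ℝ ∞ F)
    (i : Fin M.S) : ContDiff ℝ ∞ (stageMap M A F i) := by
  obtain ⟨k, hk⟩ := i
  induction k using Nat.strong_induction_on with
  | _ k ih =>
    have heq : stageMap M A F ⟨k, hk⟩ = fun z => phiFamily A z.1 z.2.2 0 (M.c ⟨k, hk⟩) z.2.1 +
        z.1 • ∑ j : Fin k, (M.a ⟨k, hk⟩ j).eval (phiFamily A z.1 z.2.2)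
          (remainder (A z.2.2) (fun v => F (v, z.2.2))
            (stageMap M A F ⟨j.val, j.isLt.trans hk⟩ z)) := by
      funext z
      unfold stageMap
      rw [Method.stage]
    rw [heq]
    have h3 : ContDiff ℝ ∞ fun z : ℝ × E × ℝ => z.2.1 := by fun_prop
    refine ((contDiff_phiFamily hA _ _).clm_apply h3).add
      (contDiff_fst.smul (ContDiff.sum fun j _ => ?_))
    exact (contDiff_phiCombEval _ (contDiff_phiFamily hA)).clm_apply
      (contDiff_remainder_comp hA hF (ih j.val j.isLt _))

theorem contDiff_stepMap (M : Method) (hA : ContDiff ℝ ∞ A) (hF : ContDiff ℝ ∞ F) :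
    ContDiff ℝ ∞ (stepMap M A F) := by
  unfold stepMap Method.step
  have h3 : ContDiff ℝ ∞ fun z : ℝ × E × ℝ => z.2.1 := by fun_prop
  refine ((contDiff_phiFamily hA _ _).clm_apply h3).add
    (contDiff_fst.smul (ContDiff.sum fun j _ => ?_))
  exact (contDiff_phiCombEval _ (contDiff_phiFamily hA)).clm_apply
    (contDiff_remainder_comp hA hF (contDiff_stageMap M hA hF j))

end smoothness

theorem stageMap_zero (M : Method) (A : ℝ → E →L[ℝ] E) (F : E × ℝ → E) (i : Fin M.S)
    (x : E × ℝ) : stageMap M A F i (0, x) = x.1 := by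
  unfold stageMap
  rw [Method.stage]
  simp [phiFamily, phi_zero_zero]

theorem stepMap_zero (M : Method) (A : ℝ → E →L[ℝ] E) (F : E × ℝ → E) (x : E × ℝ) :
    stepMap M A F (0, x) = x.1 := by
  simp [stepMap, Method.step, phiFamily, phi_zero_zero]

/-! ### Iterated time derivatives of the step map and of the flow -/

/-- The partial derivative in the first (time) variable. -/
noncomputable def timeDeriv {X : Type*} [NormedAddCommGroup X] [NormedSpace ℝ X]
    (f : ℝ × X → E) (z : ℝ × X) : E :=
  fderiv ℝ f z (1, 0)

/-- The functions `G_k` with `y⁽ᵏ⁾(t) = G_k (y(t), ε)` for every solution of `y' = F (y, ε)`. -/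
noncomputable def lieIter (F : E × ℝ → E) : ℕ → E × ℝ → E
  | 0 => Prod.fst
  | k + 1 => fun x => fderiv ℝ (lieIter F k) x (F x, 0)

section timeDeriv

variable {X : Type*} [NormedAddCommGroup X] [NormedSpace ℝ X] {f : ℝ × X → E}

theorem contDiff_timeDeriv (hf : ContDiff ℝ ∞ f) : ContDiff ℝ ∞ (timeDeriv f) :=
  (hf.fderiv_right (m := ∞) (by simp)).clm_apply contDiff_const

theorem contDiff_iterate_timeDeriv (hf : ContDiff ℝ ∞ f) (k : ℕ) :
    ContDiff ℝ ∞ (timeDeriv^[k] f) := by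
  induction k with
  | zero => exact hf
  | succ k ih =>
    rw [Function.iterate_succ_apply']
    exact contDiff_timeDeriv ih

theorem hasDerivAt_timeDeriv (hf : ContDiff ℝ ∞ f) (x : X) (s : ℝ) :
    HasDerivAt (fun s => f (s, x)) (timeDeriv f (s, x)) s := by
  have h1 : HasFDerivAt f (fderiv ℝ f (s, x)) (s, x) :=
    (hf.differentiable (by simp) _).hasFDerivAt
  exact h1.comp_hasDerivAt s ((hasDerivAt_id s).prodMk (hasDerivAt_const s x))

end timeDeriv

theorem contDiff_lieIter {F : E × ℝ → E} (hF : ContDiff ℝ ∞ F) (k : ℕ) :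
    ContDiff ℝ ∞ (lieIter F k) := by
  induction k with
  | zero => exact contDiff_fst
  | succ k ih =>
    exact (ih.fderiv_right (m := ∞) (by simp)).clm_apply (hF.prodMk contDiff_const)

theorem hasDerivWithinAt_lieIter {F : E × ℝ → E} (hF : ContDiff ℝ ∞ F) (k : ℕ) {y : ℝ → E}
    {ε t : ℝ} {S : Set ℝ} (hy : HasDerivWithinAt y (F (y t, ε)) S t) :
    HasDerivWithinAt (fun s => lieIter F k (y s, ε)) (lieIter F (k + 1) (y t, ε)) S t := by
  have h1 : HasFDerivAt (lieIter F k) (fderiv ℝ (lieIter F k) (y t, ε)) (y t, ε) :=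
    ((contDiff_lieIter hF k).differentiable (by simp) _).hasFDerivAt
  exact h1.comp_hasDerivWithinAt t (hy.prodMk (hasDerivWithinAt_const t S ε))

/-- Taylor's formula for a function `f 0` with derivatives `f 1, …, f k`, of which the first ones
vanish at `0` and the last one is within `η` of `d`. -/
theorem norm_sub_taylor_le {k : ℕ} {f : ℕ → ℝ → E} {H η : ℝ} {d : E}
    (hder : ∀ j < k, ∀ s ∈ Icc 0 H, HasDerivWithinAt (f j) (f (j + 1) s) (Icc 0 H) s)
    (h0 : ∀ j < k, f j 0 = 0) (hk : ∀ s ∈ Icc 0 H, ‖f k s - d‖ ≤ η) :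
    ∀ s ∈ Icc 0 H, ‖f 0 s - (s ^ k / k !) • d‖ ≤ η * (s ^ k / k !) := by
  induction k generalizing f with
  | zero => simpa using hk
  | succ k ih =>
    have ih' := ih (f := fun j => f (j + 1)) (fun j hj => hder (j + 1) (by lia))
      (fun j hj => h0 (j + 1) (by lia)) hk
    have hpow : ∀ s : ℝ, HasDerivAt (fun s : ℝ => s ^ (k + 1) / ((k + 1)! : ℕ))
        (s ^ k / (k ! : ℕ)) s := by
      intro s
      refine ((hasDerivAt_pow (k + 1) s).div_const (((k + 1)! : ℕ) : ℝ)).congr_deriv ?_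
      rw [Nat.factorial_succ]
      push_cast
      have : ((k ! : ℕ) : ℝ) ≠ 0 := by positivity
      field_simp
    have hd : ∀ s ∈ Icc 0 H, HasDerivWithinAt (fun s : ℝ => f 0 s - (s ^ (k + 1) / (k + 1)!) • d)
        (f 1 s - (s ^ k / k !) • d) (Icc 0 H) s := fun s hs =>
      (hder 0 (by lia) s hs).sub ((hpow s).hasDerivWithinAt.smul_const d)
    intro s hs
    refine image_norm_le_of_norm_deriv_right_le_deriv_boundary
      (B := fun s => η * (s ^ (k + 1) / (k + 1)!)) (B' := fun s => η * (s ^ k / k !))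
      (fun s hs => (hd s hs).continuousWithinAt)
      (fun s hs => (hd s ⟨hs.1, hs.2.le⟩).mono_of_mem_nhdsWithin (Icc_mem_nhdsGE_of_mem hs))
      ?_ (fun s => (hpow s).const_mul η) (fun s hs => ih' s ⟨hs.1, hs.2.le⟩) hs
    simp [h0 0 (by lia)]

/-! ### One-step methods depending on a parameter -/

/-- A smooth one-step map that starts at the identity differs from it by a map whose Lipschitz
constant on bounded sets is `O(h)`: the time derivative of the difference of two trajectories is
controlled by the Lipschitz constant of the time derivative of the map. -/
theorem exists_increment_lipschitz [FiniteDimensional ℝ E] {Ψ : ℝ × E × ℝ → E}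
    (hΨ : ContDiff ℝ ∞ Ψ) (hΨ0 : ∀ x, Ψ (0, x) = x.1) (R : ℝ) :
    ∃ K : ℝ, 0 ≤ K ∧ ∀ h ∈ Icc (0 : ℝ) 1, ∀ ε v w, |ε| ≤ R → ‖v‖ ≤ R → ‖w‖ ≤ R →
      ‖(Ψ (h, v, ε) - v) - (Ψ (h, w, ε) - w)‖ ≤ K * h * ‖v - w‖ := by
  obtain ⟨K, hK⟩ := (contDiff_timeDeriv hΨ).contDiffOn.exists_lipschitzOnWith (by simp)
    ((convex_Icc (0 : ℝ) 1).prod (convex_closedBall (0 : E × ℝ) R))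
    (isCompact_Icc.prod (isCompact_closedBall _ _))
  refine ⟨K, K.2, fun h hh ε v w hε hv hw => ?_⟩
  have hx : ∀ u : E, ‖u‖ ≤ R → ((u, ε) : E × ℝ) ∈ Metric.closedBall 0 R := fun u hu => by
    simpa [Prod.norm_def] using ⟨hu, hε⟩
  have hder : ∀ s : ℝ, HasDerivAt (fun s => Ψ (s, v, ε) - Ψ (s, w, ε))
      (timeDeriv Ψ (s, v, ε) - timeDeriv Ψ (s, w, ε)) s := fun s =>
    (hasDerivAt_timeDeriv hΨ _ s).sub (hasDerivAt_timeDeriv hΨ _ s)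
  have := norm_image_sub_le_of_norm_deriv_right_le_segment (a := 0) (b := h) (C := K * ‖v - w‖)
    (fun s _ => (hder s).continuousAt.continuousWithinAt)
    (fun s _ => (hder s).hasDerivWithinAt) (fun s hs => ?_) h ⟨hh.1, le_rfl⟩
  · simp only [hΨ0, sub_zero] at this
    calc _ = ‖Ψ (h, v, ε) - Ψ (h, w, ε) - (v - w)‖ := by congr 1; abel
      _ ≤ _ := this
      _ = _ := by ring
  · have h1 := hK.norm_sub_le (x := (s, v, ε)) (y := (s, w, ε))
      ⟨⟨hs.1, hs.2.le.trans hh.2⟩, hx v hv⟩ ⟨⟨hs.1, hs.2.le.trans hh.2⟩, hx w hw⟩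
    simpa [Prod.norm_def] using h1

/-- The local error of a one-step map along a solution, expanded to the first order `k` at which
the time derivatives of the map and of the flow may differ. -/
theorem norm_defect_sub_le {Ψ : ℝ × E × ℝ → E} (hΨ : ContDiff ℝ ∞ Ψ) {F : E × ℝ → E}
    (hF : ContDiff ℝ ∞ F) {k : ℕ}
    (hord : ∀ j < k, ∀ x, timeDeriv^[j] Ψ (0, x) = lieIter F j x) {y : ℝ → E} {T ε : ℝ}
    (hy : ∀ t ∈ Icc 0 T, HasDerivWithinAt y (F (y t, ε)) (Icc 0 T) t) {t h : ℝ} (ht : 0 ≤ t)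
    (hh : 0 ≤ h) (hth : t + h ≤ T) {d : E} {η : ℝ}
    (hd : ∀ s ∈ Icc 0 h,
      ‖timeDeriv^[k] Ψ (s, y t, ε) - lieIter F k (y (t + s), ε) - d‖ ≤ η) :
    ‖Ψ (h, y t, ε) - y (t + h) - (h ^ k / k !) • d‖ ≤ η * (h ^ k / k !) := by
  have hyt : ∀ s ∈ Icc 0 h, HasDerivWithinAt (fun s => y (t + s)) (F (y (t + s), ε))
      (Icc 0 h) s := by
    intro s hs
    have h1 := (hy (t + s) ⟨add_nonneg ht hs.1, by linarith [hs.2]⟩).scomp s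
      ((hasDerivWithinAt_id s (Icc 0 h)).const_add t)
      (fun u hu => ⟨add_nonneg ht hu.1, by linarith [hu.2]⟩)
    simpa [Function.comp_def] using h1
  refine norm_sub_taylor_le
    (f := fun j s => timeDeriv^[j] Ψ (s, y t, ε) - lieIter F j (y (t + s), ε)) ?_ ?_ hd h
    ⟨hh, le_rfl⟩
  · intro j _ s hs
    have h1 := hasDerivAt_timeDeriv (contDiff_iterate_timeDeriv hΨ j) (y t, ε) s
    rw [← Function.iterate_succ_apply' timeDeriv] at h1
    exact h1.hasDerivWithinAt.sub (hasDerivWithinAt_lieIter hF j (hyt s hs))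
  · intro j hj
    simp [hord j hj]

/-- The global error `w n - y n` of a one-step method is the accumulated local error up to the
increments, when the global error is already known to be small. -/
theorem norm_globalError_sub_le {ψ : E → E} {w y : ℕ → E} {N : ℕ} {D : E} {L c η : ℝ}
    (hw0 : w 0 = y 0) (hw : ∀ n, w (n + 1) = ψ (w n))
    (hψ : ∀ n < N, ‖(ψ (w n) - w n) - (ψ (y n) - y n)‖ ≤ L * ‖w n - y n‖) (hL : 0 ≤ L)
    (herr : ∀ n < N, ‖w n - y n‖ ≤ c) (hD : ∀ n < N, ‖ψ (y n) - y (n + 1) - D‖ ≤ η) :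
    ∀ n ≤ N, ‖w n - y n - (n : ℝ) • D‖ ≤ n * (L * c + η) := by
  intro n
  induction n with
  | zero => simp [hw0]
  | succ n ih =>
    intro hn
    have h1 := ih (by lia)
    have h2 := (hψ n (by lia)).trans (mul_le_mul_of_nonneg_left (herr n (by lia)) hL)
    have h3 := hD n (by lia)
    have heq : w (n + 1) - y (n + 1) - ((n + 1 : ℕ) : ℝ) • D =
        (w n - y n - (n : ℝ) • D) + ((ψ (w n) - w n) - (ψ (y n) - y n)) +
          (ψ (y n) - y (n + 1) - D) := by
      rw [hw]
      push_cast
      rw [add_smul, one_smul]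
      abel
    rw [heq]
    calc _ ≤ n * (L * c + η) + L * c + η := norm_add₃_le.trans (by gcongr)
      _ = _ := by push_cast; ring

/-- **Convergence of order `q` forces the order conditions.** If the time derivatives of the step
map and of the flow differed for the first time at an order `k ≤ q`, then the local errors, all
close to `h ^ k / k! • d` with `d ≠ 0` on a short time interval, would add up to a global error of
exact order `h ^ (k - 1)`. -/
theorem orderConditions_of_convergence [FiniteDimensional ℝ E] {Ψ : ℝ × E × ℝ → E}
    (hΨ : ContDiff ℝ ∞ Ψ) (hΨ0 : ∀ x, Ψ (0, x) = x.1) {F : E × ℝ → E} (hF : ContDiff ℝ ∞ F)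
    {q : ℕ} (hconv : ∀ (ε T : ℝ) (y : ℝ → E), 0 < T →
      (∀ t ∈ Icc 0 T, HasDerivWithinAt y (F (y t, ε)) (Icc 0 T) t) →
      ∃ C h₀ : ℝ, 0 < h₀ ∧ ∀ h, 0 < h → h ≤ h₀ → ∀ n : ℕ, n * h ≤ T →
        ‖(fun v => Ψ (h, v, ε))^[n] (y 0) - y (n * h)‖ ≤ C * h ^ q) :
    ∀ k ≤ q, ∀ x, timeDeriv^[k] Ψ (0, x) = lieIter F k x := by
  intro k
  induction k using Nat.strong_induction_on with
  | _ k ih =>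
  rintro hkq ⟨v₀, ε⟩
  rcases Nat.eq_zero_or_pos k with rfl | hk
  · exact hΨ0 _
  by_contra hne
  set d : E := timeDeriv^[k] Ψ (0, v₀, ε) - lieIter F k (v₀, ε) with hd
  have hdpos : 0 < ‖d‖ := norm_pos_iff.mpr (sub_ne_zero.mpr hne)
  -- a solution starting at `v₀`
  have hFε : ContDiffAt ℝ 1 (fun v => F (v, ε)) v₀ :=
    ((hF.comp (contDiff_id.prodMk contDiff_const)).of_le (by simp)).contDiffAt
  obtain ⟨y, hy0, τ₀, hτ₀, hy⟩ := 
    hFε.exists_forall_mem_closedBall_exists_eq_forall_mem_Ioo_hasDerivAt₀ 0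
  -- the defect is close to `d` near the initial point
  have hQ : ContinuousAt (fun u : ℝ × E × E =>
      timeDeriv^[k] Ψ (u.1, u.2.1, ε) - lieIter F k (u.2.2, ε)) (0, v₀, v₀) := by
    have h1 := (contDiff_iterate_timeDeriv hΨ k).continuous
    have h2 := (contDiff_lieIter hF k).continuous
    exact Continuous.continuousAt (by fun_prop)
  obtain ⟨ρ, hρ, hQρ⟩ := Metric.continuousAt_iff.mp hQ (‖d‖ / 2) (by positivity)
  have hyc : ContinuousAt y 0 := (hy 0 ⟨by linarith, by linarith⟩).continuousAt
  obtain ⟨τ₁, hτ₁, hyτ₁⟩ := Metric.continuousAt_iff.mp hyc ρ hρ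
  obtain ⟨τ, hτ, hττ⟩ : ∃ τ, 0 < τ ∧ τ < min τ₀ (min τ₁ ρ) :=
    exists_between (lt_min hτ₀ (lt_min hτ₁ hρ))
  simp only [lt_min_iff] at hττ
  have hysol : ∀ t ∈ Icc 0 τ, HasDerivWithinAt y (F (y t, ε)) (Icc 0 τ) t := fun t ht =>
    (hy t ⟨by linarith [ht.1], by linarith [ht.2]⟩).hasDerivWithinAt
  have hynear : ∀ t ∈ Icc 0 τ, dist (y t) v₀ < ρ := fun t ht => by
    have := hyτ₁ (x := t) (by
      rw [Real.dist_eq, sub_zero, abs_of_nonneg ht.1]; linarith [ht.2])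
    rwa [hy0] at this
  have hdefect : ∀ t ∈ Icc 0 τ, ∀ s, 0 ≤ s → t + s ≤ τ →
      ‖timeDeriv^[k] Ψ (s, y t, ε) - lieIter F k (y (t + s), ε) - d‖ ≤ ‖d‖ / 2 := by
    intro t ht s hs hts
    have h1 := hQρ (x := (s, y t, y (t + s))) (by
      rw [Prod.dist_eq, Prod.dist_eq, max_lt_iff, max_lt_iff]
      refine ⟨?_, hynear t ht, hynear (t + s) ⟨by linarith [ht.1], hts⟩⟩
      simp only [Real.dist_eq, sub_zero]
      rw [abs_of_nonneg hs]
      linarith [ht.1])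
    rw [dist_eq_norm] at h1
    exact h1.le
  obtain ⟨C, h₀, hh₀, herr⟩ := hconv ε τ y hτ hysol
  -- the radius bounds the parameter, the solution and, as `h ≤ 1`, the iterates
  obtain ⟨K, hK, hlip⟩ := exists_increment_lipschitz hΨ hΨ0 (‖v₀‖ + ρ + |C| + |ε|)
  -- the resulting bound for a step size that divides `τ`
  have hbound : ∀ N : ℕ, 1 ≤ N → τ / N ≤ min h₀ 1 →
      τ * (‖d‖ / 2) / (k ! : ℕ) ≤ |C| * (1 + τ * K) * (τ / N) := by
    intro N hN hNh
    have hN0 : (0 : ℝ) < N := by exact_mod_cast hN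
    set h := τ / N with hh
    have hhpos : 0 < h := by positivity
    have hNτ : (N : ℝ) * h = τ := by rw [hh]; field_simp
    obtain ⟨hhh₀, hh1⟩ := le_min_iff.mp hNh
    have hnτ : ∀ n : ℕ, n ≤ N → (n : ℝ) * h ∈ Icc 0 τ := fun n hn =>
      ⟨by positivity, by rw [← hNτ]; gcongr⟩
    have herr' : ∀ n ≤ N, ‖(fun v => Ψ (h, v, ε))^[n] (y 0) - y (n * h)‖ ≤ |C| * h ^ q :=
      fun n hn => (herr h hhpos hhh₀ n (hnτ n hn).2).trans
        (mul_le_mul_of_nonneg_right (le_abs_self C) (by positivity))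
    have hq1 : h ^ q ≤ 1 := pow_le_one₀ hhpos.le hh1
    have hyR : ∀ n ≤ N, ‖y (n * h)‖ ≤ ‖v₀‖ + ρ := fun n hn => by
      have h1 := hynear _ (hnτ n hn)
      rw [dist_eq_norm] at h1
      calc ‖y (n * h)‖ = ‖v₀ + (y (n * h) - v₀)‖ := by congr 1; abel
        _ ≤ _ := (norm_add_le _ _).trans (by linarith)
    have hC0 := abs_nonneg C
    have hε0 := abs_nonneg ε
    have hv0 := norm_nonneg v₀
    have hglob := norm_globalError_sub_le (ψ := fun v => Ψ (h, v, ε))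
      (w := fun n => (fun v => Ψ (h, v, ε))^[n] (y 0)) (y := fun n => y (n * h)) (N := N)
      (D := (h ^ k / k !) • d) (L := K * h) (c := |C| * h ^ q) (η := ‖d‖ / 2 * (h ^ k / k !))
      (by simp) (fun n => Function.iterate_succ_apply' _ _ _) (fun n hn => ?_) (by positivity)
      (fun n hn => herr' n hn.le) (fun n hn => ?_) N le_rfl
    · have h2 : (N : ℝ) * ‖(h ^ k / (k ! : ℕ)) • d‖ ≤
          |C| * h ^ q + N * (K * h * (|C| * h ^ q) + ‖d‖ / 2 * (h ^ k / (k ! : ℕ))) := by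
        have h3 : (N : ℝ) * ‖(h ^ k / (k ! : ℕ)) • d‖ = ‖(N : ℝ) • ((h ^ k / (k ! : ℕ)) • d)‖ := by
          rw [norm_smul (N : ℝ), Real.norm_natCast]
        rw [h3]
        exact (norm_le_norm_add_norm_sub _ _).trans (add_le_add (herr' N le_rfl) hglob)
      rw [norm_smul, Real.norm_of_nonneg (by positivity)] at h2
      have h3 : h ^ k * (τ * (‖d‖ / 2) / (k ! : ℕ)) ≤ |C| * (1 + τ * K) * h ^ (q + 1) := by
        rw [← hNτ]
        have h4 := mul_le_mul_of_nonneg_left h2 hhpos.le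
        rw [pow_succ]
        linear_combination h4
      have h4 : h ^ (q + 1) ≤ h ^ k * h := by
        rw [← pow_succ]
        exact pow_le_pow_of_le_one hhpos.le hh1 (by lia)
      have h5 : h ^ k * (τ * (‖d‖ / 2) / (k ! : ℕ)) ≤ h ^ k * (|C| * (1 + τ * K) * h) := by
        refine h3.trans ((mul_le_mul_of_nonneg_left h4 (by positivity)).trans_eq (by ring))
      exact le_of_mul_le_mul_left h5 (by positivity)
    · refine hlip h ⟨hhpos.le, hh1⟩ ε _ _ (by linarith) ?_ (by linarith [hyR n hn.le])
      have h1 := herr' n hn.le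
      have h2 := hyR n hn.le
      have h3 := norm_le_norm_add_norm_sub (y (n * h)) ((fun v => Ψ (h, v, ε))^[n] (y 0))
      rw [norm_sub_rev] at h3
      nlinarith
    · have h1 : ((n + 1 : ℕ) : ℝ) * h = n * h + h := by push_cast; ring
      have h2 : (n : ℝ) * h + h ≤ τ := h1 ▸ (hnτ (n + 1) hn).2
      rw [h1]
      exact norm_defect_sub_le hΨ hF (fun j hj => ih j hj (by lia)) hysol (hnτ n hn.le).1
        hhpos.le h2 fun s hs => hdefect _ (hnτ n hn.le) s hs.1 (by linarith [hs.2])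
  have hlim : Filter.Tendsto (fun N : ℕ => τ / (N : ℝ)) Filter.atTop (nhds 0) :=
    tendsto_const_div_atTop_nhds_zero_nat τ
  have hev : ∀ᶠ N : ℕ in Filter.atTop,
      τ * (‖d‖ / 2) / (k ! : ℕ) ≤ |C| * (1 + τ * K) * (τ / N) := by
    filter_upwards [Filter.eventually_ge_atTop 1,
      hlim.eventually_le_const (lt_min hh₀ one_pos)] with N h1 h2 using hbound N h1 h2
  have hle := ge_of_tendsto (hlim.const_mul (|C| * (1 + τ * K))) hev
  rw [mul_zero] at hle
  have : 0 < τ * (‖d‖ / 2) / (k ! : ℕ) := by positivity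
  linarith

/-- **Convergence uniformly in the parameter** of a one-step map that satisfies the order
conditions: the local errors are `O(h ^ (q + 1))` and the step is stable, as long as the iterates
stay in a ball; this is part of the induction. -/
theorem exists_uniform_convergence [FiniteDimensional ℝ E] {Ψ : ℝ × E × ℝ → E}
    (hΨ : ContDiff ℝ ∞ Ψ) (hΨ0 : ∀ x, Ψ (0, x) = x.1) {F : E × ℝ → E} (hF : ContDiff ℝ ∞ F)
    {q : ℕ} (hq : 1 ≤ q) (hord : ∀ k ≤ q, ∀ x, timeDeriv^[k] Ψ (0, x) = lieIter F k x)
    {R T : ℝ} (hR : 0 ≤ R) (hT : 0 < T) :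
    ∃ C h₀ : ℝ, 0 ≤ C ∧ 0 < h₀ ∧ ∀ h ε : ℝ, ∀ y : ℝ → E, 0 < h → h ≤ h₀ → ε ∈ Icc (0 : ℝ) 1 →
      (∀ t ∈ Icc 0 T, HasDerivWithinAt y (F (y t, ε)) (Icc 0 T) t) →
      (∀ t ∈ Icc 0 T, ‖y t‖ ≤ R) → ∀ n : ℕ, n * h ≤ T →
        ‖(fun v => Ψ (h, v, ε))^[n] (y 0) - y (n * h)‖ ≤ C * h ^ q := by
  obtain ⟨K, hK, hlip⟩ := exists_increment_lipschitz hΨ hΨ0 (R + 1)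
  obtain ⟨B₁, hB₁⟩ := (isCompact_Icc (a := (0 : ℝ)) (b := 1)).prod
    (isCompact_closedBall (0 : E × ℝ) (R + 1)) |>.exists_bound_of_continuousOn
    (contDiff_iterate_timeDeriv hΨ (q + 1)).continuous.continuousOn
  obtain ⟨B₂, hB₂⟩ := (isCompact_closedBall (0 : E × ℝ) (R + 1)).exists_bound_of_continuousOn
    (contDiff_lieIter hF (q + 1)).continuous.continuousOn
  set B := |B₁| + |B₂| with hB
  have hB0 : 0 ≤ B := by positivity
  set C := T * B * Real.exp (K * T) with hC
  have hC0 : 0 ≤ C := by positivity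
  refine ⟨C, 1 / (C + 1), hC0, by positivity, fun h ε y hh hhh₀ hε hy hyR => ?_⟩
  have hCh : (C + 1) * h ≤ 1 := by rwa [le_div_iff₀ (by positivity), mul_comm] at hhh₀
  have hh1 : h ≤ 1 := by nlinarith
  have hCq : C * h ^ q ≤ 1 := by
    have : h ^ q ≤ h := by simpa using pow_le_pow_of_le_one hh.le hh1 hq
    nlinarith
  have hε1 : |ε| ≤ 1 := abs_le.mpr ⟨by linarith [hε.1], hε.2⟩
  have hmem : ∀ t ∈ Icc 0 T, ((y t, ε) : E × ℝ) ∈ Metric.closedBall 0 (R + 1) := fun t ht => by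
    simp only [mem_closedBall_zero_iff, Prod.norm_def, sup_le_iff, Real.norm_eq_abs]
    exact ⟨(hyR t ht).trans (by linarith), by linarith⟩
  -- the local error
  have hloc : ∀ t ∈ Icc 0 T, t + h ≤ T → ‖Ψ (h, y t, ε) - y (t + h)‖ ≤ B * h ^ (q + 1) := by
    intro t ht hth
    have h1 := norm_defect_sub_le hΨ hF (k := q + 1) (d := 0) (η := B)
      (fun j hj => hord j (by lia)) hy ht.1 hh.le hth fun s hs => by
        rw [sub_zero, hB]
        refine (norm_sub_le _ _).trans (add_le_add ?_ ?_)
        · exact (hB₁ _ ⟨⟨hs.1, hs.2.trans hh1⟩, hmem t ht⟩).trans (le_abs_self _)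
        · exact (hB₂ _ (hmem _ ⟨by linarith [ht.1, hs.1], by linarith [hs.2]⟩)).trans
            (le_abs_self _)
    rw [smul_zero, sub_zero] at h1
    refine h1.trans (mul_le_mul_of_nonneg_left (div_le_self (by positivity) ?_) hB0)
    exact_mod_cast Nat.succ_le_of_lt (Nat.factorial_pos (q + 1))
  -- stability: `C h^q ≤ 1` keeps the iterates in the ball of radius `R + 1`
  have hmain : ∀ n : ℕ, n * h ≤ T → ‖(fun v => Ψ (h, v, ε))^[n] (y 0) - y (n * h)‖ ≤
      n * h * B * h ^ q * Real.exp (K * (n * h)) := by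
    intro n
    induction n with
    | zero => simp
    | succ n ih =>
      intro hn
      have hn1 : ((n + 1 : ℕ) : ℝ) * h = n * h + h := by push_cast; ring
      rw [hn1] at hn ⊢
      have hnT : (n : ℝ) * h ≤ T := by linarith
      have hnh0 : 0 ≤ (n : ℝ) * h := by positivity
      have ih' := ih hnT
      set w := (fun v => Ψ (h, v, ε))^[n] (y 0) with hw
      rw [Function.iterate_succ_apply', ← hw]
      have hw1 : ‖w - y (n * h)‖ ≤ 1 := by
        refine ih'.trans (le_trans ?_ hCq)
        calc (n : ℝ) * h * B * h ^ q * Real.exp (K * (n * h))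
            ≤ T * B * h ^ q * Real.exp (K * T) := by gcongr
          _ = C * h ^ q := by rw [hC]; ring
      have hwR : ‖w‖ ≤ R + 1 := by
        have h3 := norm_le_norm_add_norm_sub (y (n * h)) w
        rw [norm_sub_rev] at h3
        linarith [hyR _ ⟨hnh0, hnT⟩]
      have h1 := hlip h ⟨hh.le, hh1⟩ ε w (y (n * h)) (by linarith) hwR
        (by linarith [hyR _ ⟨hnh0, hnT⟩])
      have h2 := hloc _ ⟨hnh0, hnT⟩ hn
      have heq : Ψ (h, w, ε) - y (n * h + h) = (w - y (n * h)) +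
          ((Ψ (h, w, ε) - w) - (Ψ (h, y (n * h), ε) - y (n * h))) +
          (Ψ (h, y (n * h), ε) - y (n * h + h)) := by abel
      have hexp : (1 + K * h) * Real.exp (K * (n * h)) ≤ Real.exp (K * (n * h + h)) := by
        rw [mul_add, Real.exp_add, mul_comm]
        gcongr
        linarith [Real.add_one_le_exp (K * h)]
      have hexp1 : 1 ≤ Real.exp (K * (n * h + h)) := Real.one_le_exp (by positivity)
      have hBq : 0 ≤ B * h ^ q := by positivity
      simp only [heq]
      calc _ ≤ ‖w - y (n * h)‖ + K * h * ‖w - y (n * h)‖ + B * h ^ (q + 1) :=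
            norm_add₃_le.trans (by gcongr)
        _ = (1 + K * h) * ‖w - y (n * h)‖ + h * (B * h ^ q) * 1 := by ring
        _ ≤ (1 + K * h) * (n * h * B * h ^ q * Real.exp (K * (n * h))) +
            h * (B * h ^ q) * Real.exp (K * (n * h + h)) := by gcongr
        _ = n * h * (B * h ^ q) * ((1 + K * h) * Real.exp (K * (n * h))) +
            h * (B * h ^ q) * Real.exp (K * (n * h + h)) := by ring
        _ ≤ n * h * (B * h ^ q) * Real.exp (K * (n * h + h)) +
            h * (B * h ^ q) * Real.exp (K * (n * h + h)) := by gcongr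
        _ = _ := by ring
  intro n hn
  refine (hmain n hn).trans ?_
  calc (n : ℝ) * h * B * h ^ q * Real.exp (K * (n * h))
      ≤ T * B * h ^ q * Real.exp (K * T) := by gcongr
    _ = C * h ^ q := by rw [hC]; ring

/-! ### Cut-off, existence and uniqueness of solutions -/

open scoped Manifold in
/-- A smooth function on an open set agrees, on a uniform neighbourhood of a compact subset, with a
smooth function of compact support. -/
theorem exists_contDiff_hasCompactSupport_eq [FiniteDimensional ℝ E] {G : Type*}
    [NormedAddCommGroup G] [NormedSpace ℝ G] {K U : Set E} (hK : IsCompact K) (hU : IsOpen U)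
    (hKU : K ⊆ U) {F : E → G} (hF : ContDiffOn ℝ ∞ F U) :
    ∃ F' : E → G, ContDiff ℝ ∞ F' ∧ HasCompactSupport F' ∧ ∃ δ : ℝ, 0 < δ ∧
      ∀ x ∈ K, ∀ z, ‖z - x‖ ≤ δ → z ∈ U ∧ F' z = F z := by
  obtain ⟨K', hK', hKK', hK'U⟩ := exists_compact_between hK hU hKU
  obtain ⟨χ, hχ1, hχ0, -⟩ := exists_contMDiffMap_one_nhds_of_subset_interior (n := ⊤) 𝓘(ℝ, E)
    hK.isClosed hKK'
  have hχ : ContDiff ℝ ∞ χ := χ.contMDiff.contDiff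
  refine ⟨fun x => χ x • F x, ?_, ?_, ?_⟩
  · rw [contDiff_iff_contDiffAt]
    intro x
    by_cases hx : x ∈ U
    · exact hχ.contDiffAt.smul (hF.contDiffAt (hU.mem_nhds hx))
    · have hx' : K'ᶜ ∈ nhds x := hK'.isClosed.isOpen_compl.mem_nhds fun h => hx (hK'U h)
      refine (contDiffAt_const (c := (0 : G))).congr_of_eventuallyEq ?_
      filter_upwards [hx'] with z hz
      rw [hχ0 z hz, zero_smul]
  · refine HasCompactSupport.intro hK' fun x hx => ?_
    rw [hχ0 x hx, zero_smul]
  · have hmem : {z | χ z = 1} ∩ U ∈ nhdsSet K :=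
      Filter.inter_mem hχ1 (hU.mem_nhdsSet.mpr hKU)
    obtain ⟨O, hO, hKO, hOs⟩ := mem_nhdsSet_iff_exists.mp hmem
    obtain ⟨δ, hδ, hδO⟩ := hK.exists_cthickening_subset_open hO hKO
    refine ⟨δ, hδ, fun x hx z hz => ?_⟩
    have hz' := hOs (hδO (Metric.mem_cthickening_of_dist_le z x δ K hx (by rwa [dist_eq_norm])))
    refine ⟨hz'.2, ?_⟩
    have h1 : χ z = 1 := hz'.1
    simp only [h1, one_smul]

theorem hasDerivWithinAt_Ici_of_Icc {y : ℝ → E} {y' : E} {a b t : ℝ}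
    (hy : HasDerivWithinAt y y' (Icc a b) t) (ht : t ∈ Ico a b) :
    HasDerivWithinAt y y' (Ici t) t :=
  hy.mono_of_mem_nhdsWithin (Icc_mem_nhdsGE_of_mem ht)

/-- A bounded Lipschitz field has solutions on every time interval. -/
theorem exists_solution_of_bounded_lipschitz [CompleteSpace E] {G : E → E} {K L : NNReal}
    (hK : LipschitzWith K G) (hL : ∀ x, ‖G x‖ ≤ L) {T : ℝ} (hT : 0 ≤ T) (v₀ : E) :
    ∃ y : ℝ → E, y 0 = v₀ ∧ ∀ t ∈ Icc 0 T, HasDerivWithinAt y (G (y t)) (Icc 0 T) t := by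
  have hPL : IsPicardLindelof (fun _ => G) (tmin := 0) (tmax := T) ⟨0, le_rfl, hT⟩ v₀
      (L * T.toNNReal) 0 L K :=
    IsPicardLindelof.of_time_independent (fun x _ => hL x) hK.lipschitzOnWith (by simp [hT])
  exact hPL.exists_eq_forall_mem_Icc_hasDerivWithinAt₀

/-- Solutions of the perturbed problem `y' = F y - ε B y` exist on the whole interval and are
`O(ε)`-close to the unperturbed solution, when `F` and `B` are bounded and Lipschitz. -/
theorem exists_perturbed_solution [CompleteSpace E] {F B : E → E} {L b : NNReal}
    (hFL : LipschitzWith L F) (hBL : LipschitzWith L B) (hFb : ∀ x, ‖F x‖ ≤ b)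
    (hBb : ∀ x, ‖B x‖ ≤ b) {T : ℝ} (hT : 0 ≤ T) {V : ℝ → E}
    (hV : ∀ t ∈ Icc 0 T, HasDerivWithinAt V (F (V t)) (Icc 0 T) t) :
    ∃ C : ℝ, 0 ≤ C ∧ ∀ ε ∈ Icc (0 : ℝ) 1, ∃ y : ℝ → E, y 0 = V 0 ∧
      (∀ t ∈ Icc 0 T, HasDerivWithinAt y (F (y t) - ε • B (y t)) (Icc 0 T) t) ∧
      ∀ t ∈ Icc 0 T, ‖y t - V t‖ ≤ C * ε := by
  -- a positive Lipschitz constant avoids the degenerate case of the Grönwall bound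
  set K : NNReal := L + L + 1 with hK
  have hKpos : (0 : ℝ) < K := by positivity
  have hexp : 0 ≤ Real.exp (K * T) - 1 := by
    linarith [Real.one_le_exp (x := K * T) (by positivity)]
  refine ⟨b / K * (Real.exp (K * T) - 1), by positivity, fun ε hε => ?_⟩
  have hlip : LipschitzWith K fun x => F x - ε • B x := by
    refine LipschitzWith.of_dist_le_mul fun x z => ?_
    have h1 := hFL.dist_le_mul x z
    have h2 := hBL.dist_le_mul x z
    rw [dist_eq_norm, dist_eq_norm] at h1 h2
    rw [dist_eq_norm, dist_eq_norm]
    have heq : F x - ε • B x - (F z - ε • B z) = (F x - F z) - ε • (B x - B z) := by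
      rw [smul_sub]; abel
    rw [heq]
    have h3 : ‖ε • (B x - B z)‖ ≤ 1 * (L * ‖x - z‖) := by
      rw [norm_smul, Real.norm_of_nonneg hε.1]
      exact mul_le_mul hε.2 h2 (norm_nonneg _) zero_le_one
    have h4 := norm_sub_le (F x - F z) (ε • (B x - B z))
    have h5 := norm_nonneg (x - z)
    rw [hK]
    push_cast
    linarith
  have hεB : ∀ x, ‖ε • B x‖ ≤ ε * b := fun x => by
    rw [norm_smul, Real.norm_of_nonneg hε.1]
    exact mul_le_mul_of_nonneg_left (hBb x) hε.1
  have hbd : ∀ x, ‖F x - ε • B x‖ ≤ ((b + b : NNReal) : ℝ) := fun x => by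
    have h1 := norm_sub_le (F x) (ε • B x)
    have h2 : ε * b ≤ 1 * b := mul_le_mul_of_nonneg_right hε.2 b.2
    have h3 := hεB x
    have h4 := hFb x
    push_cast
    linarith
  obtain ⟨y, hy0, hy⟩ := exists_solution_of_bounded_lipschitz hlip hbd hT (V 0)
  refine ⟨y, hy0, hy, fun t ht => ?_⟩
  have hgr := dist_le_of_approx_trajectories_ODE (v := fun _ x => F x - ε • B x) (K := K)
    (a := 0) (b := T) (f := y) (g := V) (εf := 0) (εg := ε * b) (δ := 0) (fun _ => hlip)
    (fun s hs => (hy s hs).continuousWithinAt)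
    (fun s hs => hasDerivWithinAt_Ici_of_Icc (hy s ⟨hs.1, hs.2.le⟩) hs) (by simp)
    (fun s hs => (hV s hs).continuousWithinAt)
    (fun s hs => hasDerivWithinAt_Ici_of_Icc (hV s ⟨hs.1, hs.2.le⟩) hs)
    (fun s _ => by simpa [dist_eq_norm] using hεB (V s)) (by simp [hy0]) t ht
  rw [dist_eq_norm, gronwallBound_of_K_ne_0 hKpos.ne'] at hgr
  refine hgr.trans ?_
  have h1 : Real.exp (K * (t - 0)) ≤ Real.exp (K * T) := by
    rw [sub_zero]
    gcongr
    exact ht.2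
  have h2 : 0 ≤ ε * b / K := div_nonneg (mul_nonneg hε.1 b.2) hKpos.le
  calc 0 * Real.exp (K * (t - 0)) + (0 + ε * b) / K * (Real.exp (K * (t - 0)) - 1)
      = ε * b / K * (Real.exp (K * (t - 0)) - 1) := by ring
    _ ≤ ε * b / K * (Real.exp (K * T) - 1) := by gcongr
    _ = _ := by ring

theorem IsSolution.continuousOn {F : E → E} {U : Set E} {T : ℝ} {V : ℝ → E}
    (hV : IsSolution F U T V) : ContinuousOn V (Icc 0 T) :=
  fun t ht => (hV t ht).2.continuousWithinAt

theorem IsSolution.eqOn [FiniteDimensional ℝ E] {F : E → E} {U : Set E} {T : ℝ} {V W : ℝ → E}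
    (hU : IsOpen U) (hF : ContDiffOn ℝ ∞ F U) (hV : IsSolution F U T V)
    (hW : IsSolution F U T W) (h0 : V 0 = W 0) : EqOn V W (Icc 0 T) := by
  have hKc : IsCompact (V '' Icc 0 T ∪ W '' Icc 0 T) :=
    (isCompact_Icc.image_of_continuousOn hV.continuousOn).union
      (isCompact_Icc.image_of_continuousOn hW.continuousOn)
  obtain ⟨F', hF', hF'c, δ, hδ, heq⟩ := exists_contDiff_hasCompactSupport_eq hKc hU
    (union_subset (image_subset_iff.mpr fun t ht => (hV t ht).1)
      (image_subset_iff.mpr fun t ht => (hW t ht).1)) hF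
  obtain ⟨K, hK⟩ := hF'.lipschitzWith_of_hasCompactSupport hF'c (by simp)
  have hval : ∀ x ∈ V '' Icc 0 T ∪ W '' Icc 0 T, F' x = F x := fun x hx =>
    (heq x hx x (by simpa using hδ.le)).2
  refine ODE_solution_unique (v := fun _ => F') (fun _ => hK) hV.continuousOn (fun t ht => ?_)
    hW.continuousOn (fun t ht => ?_) h0
  · have ht' : t ∈ Icc 0 T := ⟨ht.1, ht.2.le⟩
    rw [hval _ (Or.inl (mem_image_of_mem V ht'))]
    exact hasDerivWithinAt_Ici_of_Icc (hV t ht').2 ht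
  · have ht' : t ∈ Icc 0 T := ⟨ht.1, ht.2.le⟩
    rw [hval _ (Or.inr (mem_image_of_mem W ht'))]
    exact hasDerivWithinAt_Ici_of_Icc (hW t ht').2 ht

theorem contDiffOn_modifiedRhs {F : E → E} {U : Set E} (hF : ContDiffOn ℝ ∞ F U) (p : ℕ)
    (γ h : ℝ) (A : E →L[ℝ] E) : ContDiffOn ℝ ∞ (modifiedRhs p γ h A F) U :=
  hF.sub ((ContinuousLinearMap.contDiff _).const_smul _).contDiffOn

/-! ### Stages and iterates of the scheme -/

theorem Method.iter_eq_iterate (M : Method) (Φ : ℕ → ℝ → E →L[ℝ] E) (h : ℝ) (r : E → E) (v : E)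
    (n : ℕ) : M.iter Φ h r v n = (M.step Φ h r)^[n] v := by
  induction n with
  | zero => rfl
  | succ n ih => rw [Function.iterate_succ_apply', ← ih]; rfl

/-- Two remainders that agree at the stages of one scheme have the same stages. -/
theorem Method.stage_congr (M : Method) {Φ : ℕ → ℝ → E →L[ℝ] E} {h : ℝ} {r r' : E → E} {v : E}
    (hr : ∀ j, r' (M.stage Φ h r v j) = r (M.stage Φ h r v j)) (i : Fin M.S) :
    M.stage Φ h r' v i = M.stage Φ h r v i := by
  obtain ⟨k, hk⟩ := i
  induction k using Nat.strong_induction_on with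
  | _ k ih =>
    rw [Method.stage, Method.stage]
    congr 2
    refine Finset.sum_congr rfl fun j _ => ?_
    simp only
    rw [ih j.val j.isLt, hr]

theorem Method.step_congr (M : Method) {Φ : ℕ → ℝ → E →L[ℝ] E} {h : ℝ} {r r' : E → E} {v : E}
    (hr : ∀ j, r' (M.stage Φ h r v j) = r (M.stage Φ h r v j)) :
    M.step Φ h r' v = M.step Φ h r v := by
  simp only [Method.step, M.stage_congr hr, hr]

/-- On bounded sets the stages are within any given distance of the current value, for small step
sizes. -/
theorem exists_stageMap_near [FiniteDimensional ℝ E] (M : Method) {A : ℝ → E →L[ℝ] E}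
    {F : E × ℝ → E} (hA : ContDiff ℝ ∞ A) (hF : ContDiff ℝ ∞ F) (R : ℝ) {δ : ℝ} (hδ : 0 < δ) :
    ∃ h₀ : ℝ, 0 < h₀ ∧ ∀ h ε v, 0 < h → h ≤ h₀ → |ε| ≤ R → ‖v‖ ≤ R → ∀ i,
      ‖stageMap M A F i (h, v, ε) - v‖ ≤ δ := by
  have hK : ∀ i, ∃ K : NNReal, LipschitzOnWith K (stageMap M A F i)
      (Icc (0 : ℝ) 1 ×ˢ Metric.closedBall (0 : E × ℝ) R) := fun i =>
    (contDiff_stageMap M hA hF i).contDiffOn.exists_lipschitzOnWith (by simp)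
      ((convex_Icc (0 : ℝ) 1).prod (convex_closedBall (0 : E × ℝ) R))
      (isCompact_Icc.prod (isCompact_closedBall _ _))
  choose K hK using hK
  set L : NNReal := ∑ i, K i with hL
  refine ⟨min 1 (δ / (L + 1)), by positivity, fun h ε v hh hh₀ hε hv i => ?_⟩
  obtain ⟨hh1, hhL⟩ := le_min_iff.mp hh₀
  have hx : ((v, ε) : E × ℝ) ∈ Metric.closedBall 0 R := by
    simpa [Prod.norm_def] using ⟨hv, hε⟩
  have h1 := (hK i).norm_sub_le (x := (h, v, ε)) (y := (0, v, ε)) ⟨⟨hh.le, hh1⟩, hx⟩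
    ⟨⟨le_rfl, zero_le_one⟩, hx⟩
  rw [stageMap_zero] at h1
  have h2 : ‖((h, v, ε) : ℝ × E × ℝ) - (0, v, ε)‖ = h := by
    simp [Prod.norm_def, abs_of_pos hh, hh.le]
  have h3 : K i ≤ L := Finset.single_le_sum (fun _ _ => zero_le) (Finset.mem_univ i)
  have h4 : (K i : ℝ) ≤ L := by exact_mod_cast h3
  rw [h2] at h1
  rw [le_div_iff₀ (by positivity)] at hhL
  nlinarith

/-- The step maps of a method of order `q` satisfy the order conditions, for every smooth family
of problems and splittings. -/
theorem Method.HasOrder.orderConditions {E : Type} [NormedAddCommGroup E] [NormedSpace ℝ E]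
    [FiniteDimensional ℝ E] {M : Method} {q : ℕ} (hM : M.HasOrder q) {A : ℝ → E →L[ℝ] E}
    {F : E × ℝ → E} (hA : ContDiff ℝ ∞ A) (hF : ContDiff ℝ ∞ F) :
    ∀ k ≤ q, ∀ x, timeDeriv^[k] (stepMap M A F) (0, x) = lieIter F k x := by
  refine orderConditions_of_convergence (contDiff_stepMap M hA hF) (stepMap_zero M A F) hF ?_
  intro ε T y hT hy
  obtain ⟨C, h₀, hh₀, hC⟩ := hM E (A ε) univ (fun v => F (v, ε)) T y isOpen_univ
    (hF.comp (contDiff_id.prodMk contDiff_const)).contDiffOn hT fun t ht => ⟨mem_univ _, hy t ht⟩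
  refine ⟨C, h₀, hh₀, fun h hh hhh₀ n hn => ?_⟩
  have := hC h hh hhh₀ n hn
  rwa [M.iter_eq_iterate] at this

/-! ### The modified scheme -/

/-- The operator `h A - (-h² A² / γ²)^p` of the modified scheme is `h` times the operator of the
modified problem. -/
theorem phiMod_eq_phiFamily {p : ℕ} (hp : 1 ≤ p) (γ h : ℝ) (A : E →L[ℝ] E) :
    (fun s c => phiMod p γ s c (h • A)) =
      phiFamily (fun ε => A - ε • (-(A ^ 2)) ^ p) h (h ^ (2 * p - 1) / γ ^ (2 * p)) := by
  funext s c
  unfold phiMod phiFamily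
  congr 2
  rw [smul_sub, smul_smul, smul_pow, smul_smul, ← smul_neg, smul_pow]
  congr 2
  obtain ⟨m, rfl⟩ : ∃ m, p = m + 1 := ⟨p - 1, by lia⟩
  rw [show 2 * (m + 1) - 1 = 2 * m + 1 by lia, mul_pow, inv_pow, ← pow_mul, ← pow_mul,
    ← mul_div_assoc, ← pow_succ', inv_mul_eq_div]
  rfl

end ETD

theorem mainTheorem9
    (M : ETD.Method) (q : ℕ) (hq : 1 ≤ q) (hM : M.HasOrder q)
    (p : ℕ) (hp : 1 ≤ p) (γ : ℝ) (hγ : 0 < γ)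
    (E : Type) [NormedAddCommGroup E] [NormedSpace ℝ E] [FiniteDimensional ℝ E]
    (A : E →L[ℝ] E) (U : Set E) (hU : IsOpen U)
    (F : E → E) (hF : ContDiffOn ℝ ∞ F U)
    (T : ℝ) (hT : 0 < T) (V : ℝ → E) (hV : ETD.IsSolution F U T V) :
    ∃ C : ℝ, ∃ h₀ : ℝ, 0 < h₀ ∧ ∀ h : ℝ, 0 < h → h ≤ h₀ →
      ∃ Vγ : ℝ → E,
        -- `Vγ` is the unique solution of the modified problem with the same initial value
        (ETD.IsSolution (ETD.modifiedRhs p γ h A F) U T Vγ ∧ Vγ 0 = V 0) ∧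
        (∀ W : ℝ → E,
          ETD.IsSolution (ETD.modifiedRhs p γ h A F) U T W → W 0 = V 0 →
            Set.EqOn W Vγ (Set.Icc 0 T)) ∧
        -- the modified iterates and stages stay in the domain of `F`, and the error is `O(h^q)`
        ∀ n : ℕ, n * h ≤ T →
          M.iter (fun s c => ETD.phiMod p γ s c (h • A)) h (ETD.remainder A F) (V 0) n ∈ U ∧
          (∀ i : Fin M.S,
            M.stage (fun s c => ETD.phiMod p γ s c (h • A)) h (ETD.remainder A F)
              (M.iter (fun s c => ETD.phiMod p γ s c (h • A)) h (ETD.remainder A F) (V 0) n) i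
                ∈ U) ∧
          ‖M.iter (fun s c => ETD.phiMod p γ s c (h • A)) h (ETD.remainder A F) (V 0) n
              - Vγ (n * h)‖ ≤ C * h ^ q := by
  set B : E →L[ℝ] E := (-(A ^ 2)) ^ p with hB
  -- `F` and `B` are cut off together, away from the trajectory of `V`
  have hcomp : IsCompact (V '' Icc 0 T) := isCompact_Icc.image_of_continuousOn hV.continuousOn
  obtain ⟨G, hG, hGc, δ, hδ, hGeq⟩ := ETD.exists_contDiff_hasCompactSupport_eq hcomp hU
    (image_subset_iff.mpr fun t ht => (hV t ht).1) (hF.prodMk (g := B) B.contDiff.contDiffOn)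
  have hnear : ∀ t ∈ Icc 0 T, ∀ z, ‖z - V t‖ ≤ δ → z ∈ U ∧ (G z).1 = F z ∧ (G z).2 = B z :=
    fun t ht z hz => by
      obtain ⟨h1, h2⟩ := hGeq _ (mem_image_of_mem V ht) z hz
      simp [h1, h2]
  obtain ⟨L, hL⟩ := hG.lipschitzWith_of_hasCompactSupport hGc (by simp)
  obtain ⟨b, hb⟩ := hGc.exists_bound_of_continuous hG.continuous
  have hb' : ∀ x, ‖G x‖ ≤ b.toNNReal := fun x => (hb x).trans (Real.le_coe_toNNReal b)
  obtain ⟨R, hR⟩ := hcomp.isBounded.exists_norm_le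
  have hR' : ∀ t ∈ Icc 0 T, ‖V t‖ ≤ R := fun t ht => hR _ (mem_image_of_mem V ht)
  have hR0 : 0 ≤ R := (norm_nonneg _).trans (hR' 0 ⟨le_rfl, hT.le⟩)
  -- solutions of the modified problems
  obtain ⟨C₁, hC₁, hsol⟩ := ETD.exists_perturbed_solution (F := fun x => (G x).1)
    (B := fun x => (G x).2) (L := L) (b := b.toNNReal)
    (by simpa [Function.comp_def] using LipschitzWith.prod_fst.comp hL)
    (by simpa [Function.comp_def] using LipschitzWith.prod_snd.comp hL)
    (fun x => (norm_fst_le _).trans (hb' x)) (fun x => (norm_snd_le _).trans (hb' x)) hT.le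
    (V := V) fun t ht => by
      simp only [(hnear t ht (V t) (by simpa using hδ.le)).2.1]
      exact (hV t ht).2
  -- the modified scheme, for the family of problems with perturbation parameter `ε`
  set Aε : ℝ → E →L[ℝ] E := fun ε => A - ε • B with hAε
  set Fε : E × ℝ → E := fun x => (G x.1).1 - x.2 • (G x.1).2 with hFε
  have hAs : ContDiff ℝ ∞ Aε := contDiff_const.sub (contDiff_id.smul contDiff_const)
  have hFs : ContDiff ℝ ∞ Fε := by
    have h1 : ContDiff ℝ ∞ fun x : E × ℝ => G x.1 := hG.comp contDiff_fst
    exact h1.fst.sub (contDiff_snd.smul h1.snd)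
  obtain ⟨C, h₁, hC, hh₁, hconv⟩ := ETD.exists_uniform_convergence
    (ETD.contDiff_stepMap M hAs hFs) (ETD.stepMap_zero M Aε Fε) hFs hq
    (hM.orderConditions hAs hFs) (R := R + C₁) (by linarith) hT
  obtain ⟨h₂, hh₂, hstage⟩ := ETD.exists_stageMap_near M hAs hFs (R + C₁ + δ + 1) (δ := δ / 3)
    (by positivity)
  have hγp : 0 < γ ^ (2 * p) := by positivity
  -- the last bounds on `h` make `ε ≤ 1`, `C₁ ε ≤ δ / 3` and `C h^q ≤ δ / 3`, so that a stage, an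
  -- iterate, the modified solution and `V` are successively at distance at most `δ / 3`
  refine ⟨C, min (min h₁ h₂) (min (min 1 (γ ^ (2 * p)))
    (min (δ / 3 * γ ^ (2 * p) / (C₁ + 1)) (δ / 3 / (C + 1)))), by positivity,
    fun h hh hh₀ => ?_⟩
  simp only [le_min_iff] at hh₀
  obtain ⟨⟨hh1, hh2⟩, ⟨hh3, hh4⟩, hh5, hh6⟩ := hh₀
  set ε : ℝ := h ^ (2 * p - 1) / γ ^ (2 * p) with hε
  have hεh : ε ≤ h / γ ^ (2 * p) := by
    rw [hε]
    gcongr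
    simpa using pow_le_pow_of_le_one hh.le hh3 (show 1 ≤ 2 * p - 1 by lia)
  have hε0 : 0 ≤ ε := by positivity
  have hε1 : ε ≤ 1 := hεh.trans ((div_le_one hγp).mpr hh4)
  have hC₁ε : C₁ * ε ≤ δ / 3 := by
    rw [le_div_iff₀ (by positivity)] at hh5
    rw [le_div_iff₀ hγp] at hεh
    have h1 : ε * γ ^ (2 * p) * (C₁ + 1) ≤ δ / 3 * γ ^ (2 * p) :=
      (mul_le_mul_of_nonneg_right hεh (by positivity)).trans hh5
    have h2 : ε * (C₁ + 1) ≤ δ / 3 := by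
      refine le_of_mul_le_mul_right ?_ hγp
      linarith
    linarith
  have hChq : C * h ^ q ≤ δ / 3 := by
    rw [le_div_iff₀ (by positivity)] at hh6
    have : h ^ q ≤ h := by simpa using pow_le_pow_of_le_one hh.le hh3 hq
    nlinarith
  obtain ⟨y, hy0, hy, hyV⟩ := hsol ε ⟨hε0, hε1⟩
  have hyV' : ∀ t ∈ Icc 0 T, ‖y t - V t‖ ≤ δ / 3 := fun t ht => (hyV t ht).trans hC₁ε
  have hyR : ∀ t ∈ Icc 0 T, ‖y t‖ ≤ R + C₁ := fun t ht => by
    have h1 := norm_le_norm_add_norm_sub (V t) (y t)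
    rw [norm_sub_rev] at h1
    have h2 := hyV t ht
    have h3 := hR' t ht
    nlinarith
  have hysol : ETD.IsSolution (ETD.modifiedRhs p γ h A F) U T y := fun t ht => by
    obtain ⟨h1, h2, h3⟩ := hnear t ht (y t) ((hyV' t ht).trans (by linarith))
    refine ⟨h1, ?_⟩
    have h4 := hy t ht
    rwa [h2, h3] at h4
  have hyerr := hconv h ε y hh hh1 ⟨hε0, hε1⟩ hy hyR
  set w : ℕ → E := fun n => (fun v => ETD.stepMap M Aε Fε (h, v, ε))^[n] (y 0) with hw
  have hyerr' : ∀ n : ℕ, n * h ≤ T → ‖w n - y (n * h)‖ ≤ C * h ^ q := hyerr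
  have hwV : ∀ n : ℕ, n * h ≤ T → ‖w n - V (n * h)‖ ≤ δ / 3 + δ / 3 := fun n hn => by
    have h1 := norm_sub_le_norm_sub_add_norm_sub (w n) (y (n * h)) (V (n * h))
    linarith [hyerr' n hn, hyV' _ ⟨by positivity, hn⟩]
  -- the stages of the cut-off scheme stay where the cut-off has no effect
  have hstageV : ∀ n : ℕ, n * h ≤ T → ∀ i,
      ‖ETD.stageMap M Aε Fε i (h, w n, ε) - V (n * h)‖ ≤ δ := fun n hn i => by
    have hnT : (n : ℝ) * h ∈ Icc 0 T := ⟨by positivity, hn⟩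
    have h1 := norm_le_norm_add_norm_sub (V (n * h)) (w n)
    rw [norm_sub_rev] at h1
    have h2 := hstage h ε (w n) hh hh2 (by rw [abs_of_nonneg hε0]; linarith)
      (by linarith [hR' _ hnT, hwV n hn]) i
    have h3 := norm_sub_le_norm_sub_add_norm_sub (ETD.stageMap M Aε Fε i (h, w n, ε)) (w n)
      (V (n * h))
    linarith [hwV n hn]
  have hr : ∀ n : ℕ, n * h ≤ T → ∀ i,
      ETD.remainder A F (ETD.stageMap M Aε Fε i (h, w n, ε)) =
        ETD.remainder (Aε ε) (fun v => Fε (v, ε)) (ETD.stageMap M Aε Fε i (h, w n, ε)) := by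
    intro n hn i
    obtain ⟨-, h2, h3⟩ := hnear _ ⟨by positivity, hn⟩ _ (hstageV n hn i)
    generalize ETD.stageMap M Aε Fε i (h, w n, ε) = z at h2 h3 ⊢
    change F z - A z = (G z).1 - ε • (G z).2 - (A - ε • B) z
    rw [h2, h3, sub_apply, smul_apply]
    abel
  rw [ETD.phiMod_eq_phiFamily hp γ h A]
  have hiter : ∀ n : ℕ, n * h ≤ T →
      M.iter (ETD.phiFamily Aε h ε) h (ETD.remainder A F) (V 0) n = w n := by
    intro n
    induction n with
    | zero => exact fun _ => hy0.symm
    | succ n ih =>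
      intro hn
      have hn' : (n : ℝ) * h ≤ T := by
        push_cast at hn
        linarith
      change M.step _ _ _ (M.iter _ _ _ _ n) = _
      rw [ih hn', hw]
      simp only [Function.iterate_succ_apply']
      exact M.step_congr (hr n hn')
  refine ⟨y, ⟨hysol, hy0⟩, fun W hW hW0 => hW.eqOn hU (ETD.contDiffOn_modifiedRhs hF p γ h A)
    hysol (hW0.trans hy0.symm), fun n hn => ?_⟩
  have hnT : (n : ℝ) * h ∈ Icc 0 T := ⟨by positivity, hn⟩
  rw [hiter n hn]
  refine ⟨(hnear _ hnT _ ((hwV n hn).trans (by linarith))).1, fun i => ?_, hyerr' n hn⟩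
  rw [M.stage_congr (hr n hn) i]
  exact (hnear _ hnT _ (hstageV n hn i)).1
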